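/- **Theorem (Thompson Sampling for bandits).** There is an absolute constant $C>0$ such that the following holds. Let $d,T$ be numbers of arms and of rounds, and let $(\ell_t(i))_{1\le t\le T,\,1\le i\le d}$ be random losses in $[0,1]$ with an arbitrary joint distribution (the prior, known to the player). Let $a^*\in\arg\min_{1\le i\le d}\sum_{t=1}^T\ell_t(i)$ be a random optimal arm (ties broken measurably, in any way), let $L^*=\min_{1\le i\le d}\sum_{t=1}^T\ell_t(i)$, let $p_1$ be the law of $a^*$, and let $H(p_1)=\sum_{i} p_1(i)\log\frac{1}{p_1(i)}$ be its Shannon entropy. In each round $t$ the player plays an arm $a_t$ and then observes only $\ell_t(a_t)$. Thompson Sampling draws $a_t$ with fresh randomness from the posterior law $p_t$ of $a^*$ given $a_1,\ell_1(a_1),\dots,a_{t-1},\ell_{t-1}(a_{t-1})$; that is, conditionally on the whole loss sequence, $a^*$ and $a_1,\dots,a_{t-1}$, the arm $a_t$ has law $p_t$. Let $R_T=\sum_{t=1}^T\ell_t(a_t)-L^*$ be its regret. If $\underline{L}^*>0$ is a constant such that $L^*\le\underline{L}^*$ almost surely, then $$\mathbb{E}[R_T]\le C\left(\sqrt{H(p_1)\,d\,\underline{L}^*}+d\,(\log\underline{L}^*)^2+d\log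 T\right).$$ -/

import Mathlib

open MeasureTheory ProbabilityTheory

noncomputable section

namespace BayesBandit

variable {Ω : Type*} {T d : ℕ}

/-- Total loss over all `T` rounds of the fixed arm `i`; here `loss t i ω` is the loss
`ℓ_t(i)` of arm `i` in round `t`. -/
def armLoss (loss : Fin T → Fin d → Ω → ℝ) (i : Fin d) (ω : Ω) : ℝ :=
  ∑ t, loss t i ω

/-- `L^*`, the total loss of the best fixed arm in hindsight. -/
def bestLoss (loss : Fin T → Fin d → Ω → ℝ) (ω : Ω) : ℝ :=
  ⨅ i, armLoss loss i ω

/-- Cumulative regret: the loss of the arms `act t` that were played, minus `L^*`. -/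
def regret (loss : Fin T → Fin d → Ω → ℝ) (act : Fin T → Ω → Fin d) (ω : Ω) : ℝ :=
  (∑ t, loss t (act t ω) ω) - bestLoss loss ω

/-- What the player knows at the beginning of round `t` under bandit feedback: in each earlier
round `s`, the arm that was played and the loss of that arm. -/
@[reducible] def history (loss : Fin T → Fin d → Ω → ℝ) (act : Fin T → Ω → Fin d) (t : Fin T) :
    MeasurableSpace Ω :=
  ⨆ s : {s : Fin T // s < t},
    MeasurableSpace.comap (fun ω => (act s ω, loss s (act s ω) ω)) inferInstance

/-- Everything that is settled when the player draws an arm in round `t`: the complete loss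
sequence (fixed in advance by the oblivious adversary), the optimal arm, and the arms played in
the earlier rounds. -/
@[reducible] def environment (loss : Fin T → Fin d → Ω → ℝ) (best : Ω → Fin d) (act : Fin T → Ω → Fin d)
    (t : Fin T) : MeasurableSpace Ω :=
  MeasurableSpace.comap (fun ω => ((fun t i => loss t i ω : Fin T → Fin d → ℝ), best ω))
      inferInstance
    ⊔ ⨆ s : {s : Fin T // s < t}, MeasurableSpace.comap (act s) inferInstance

variable [MeasurableSpace Ω]

/-- A random loss sequence in `[0,1]^(T × d)`, with arbitrary joint law (the prior), and a
random arm `best`, written `a^*`, that minimizes the total loss (ties broken measurably, in any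
way). -/
structure IsBayesianBandit (loss : Fin T → Fin d → Ω → ℝ) (best : Ω → Fin d) : Prop where
  measurable_loss : ∀ t i, Measurable (loss t i)
  loss_mem : ∀ t i ω, loss t i ω ∈ Set.Icc (0 : ℝ) 1
  measurable_best : Measurable best
  best_le : ∀ ω i, armLoss loss (best ω) ω ≤ armLoss loss i ω

/-- The posterior probability `p_t(i)` that arm `i` is the optimal arm, given the bandit
feedback of the rounds before `t`. -/
def armPosterior (P : Measure Ω) (loss : Fin T → Fin d → Ω → ℝ) (best : Ω → Fin d)
    (act : Fin T → Ω → Fin d) (t : Fin T) (i : Fin d) : Ω → ℝ :=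
  P⟦best ⁻¹' {i} | history loss act t⟧

/-- The arms `act t` are played by Thompson Sampling with bandit feedback: in round `t` the arm
is drawn from the posterior law `p_t` of the optimal arm, with fresh randomness. That is, the
conditional law of `act t` given the loss sequence, the optimal arm and the past is `p_t`. -/
structure IsThompsonSampling (P : Measure Ω) (loss : Fin T → Fin d → Ω → ℝ)
    (best : Ω → Fin d) (act : Fin T → Ω → Fin d) : Prop where
  measurable_act : ∀ t, Measurable (act t)
  condProb_act : ∀ t i,
    P⟦act t ⁻¹' {i} | environment loss best act t⟧ =ᵐ[P] armPosterior P loss best act t i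

/-- The Shannon entropy `H(p_1)` (in nats) of the prior law `p_1` of the optimal arm. -/
def priorEntropy (P : Measure Ω) (best : Ω → Fin d) : ℝ :=
  ∑ i, Real.negMulLog (P.real (best ⁻¹' {i}))

end BayesBandit

end

namespace BayesBandit

/-! ### Elementary inequalities -/

/-! Fix one arm. Let A indicate that it is optimal, p_n be its posterior probability, B_n the
indicator that it is drawn and x_n its loss. As draws follow the posterior, the expected regret is
the sum over arms and rounds of E[(p_n - A) x_n] (`integral_regret_eq`). Each arm is treated
separately, with a threshold γ for p_n.

Rare rounds, p_n ≤ γ (`sum_integral_min_le`). Weight the observed losses by min(1, γ/p_n), so that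
their conditional mean is min(p_n, γ) x_n ≤ γ x_n, and let N_n be their sum before round n. Then
exp(N_n - 2γ ∑ x) has expectation at most 1. If the arm is optimal, its total loss is at most L;
with γ = log T / L this gives E[p_n exp N_n] = E[A exp N_n] ≤ T². So rounds with N_n ≥ 3 log T
contribute at most 1/T each, the earlier ones at most 3 log T + 1 together, and ∑ E[min(p_n, γ) x_n]
is O(log T).

Common rounds, p_n > γ (`integral_mul_log_step`). The Fenchel inequality for q log q, tested against
(c/p_n) B_n x_n, shows that E[p log p] grows per round by at least c E[(p_n - A) x_n] - c² E[x_n],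
both restricted to p_n > γ. Telescoping bounds the total growth by the arm's term in the prior
entropy. As x_n ≤ min(p_n, γ) x_n / γ on these rounds, the quadratic cost is O(log T)/γ = O(L): the
logarithm cancels. Summing over arms and optimizing c gives √(H d L) + d log T. -/

lemma exp_le_one_add_two_mul {y : ℝ} (h0 : 0 ≤ y) (h1 : y ≤ 1) : Real.exp y ≤ 1 + 2 * y := by
  have h := Real.abs_exp_sub_one_sub_id_le (x := y) (by rw [abs_of_nonneg h0]; exact h1)
  nlinarith [(abs_le.1 h).2]

/-- Follows from exp(-y) ≤ 1/(1+y) and (1+y)(1-y+y²) = 1+y³ ≥ 1. -/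
lemma exp_neg_le_quadratic {y : ℝ} (h0 : 0 ≤ y) : Real.exp (-y) ≤ 1 - y + y ^ 2 := by
  have h1 : y + 1 ≤ Real.exp y := Real.add_one_le_exp y
  have h2 : Real.exp (-y) * Real.exp y = 1 := by rw [← Real.exp_add]; simp
  have h3 : 0 < Real.exp (-y) := Real.exp_pos _
  nlinarith [pow_nonneg h0 3, mul_le_mul_of_nonneg_left h1 h3.le, sq_nonneg (y - 1)]

/-- The Fenchel inequality for `q ↦ q log q`. -/
lemma mul_log_fenchel {q m : ℝ} (θ : ℝ) (hq : 0 ≤ q) (hm : 0 < m) :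
    q * Real.log m + q + θ * q - m * Real.exp θ ≤ q * Real.log q := by
  rcases hq.eq_or_lt with rfl | hq
  · simp only [zero_mul, mul_zero, add_zero, zero_sub]
    have := mul_pos hm (Real.exp_pos θ)
    linarith
  · have h := Real.log_le_sub_one_of_pos (x := m * Real.exp θ / q)
      (div_pos (mul_pos hm (Real.exp_pos θ)) hq)
    rw [Real.log_div (mul_pos hm (Real.exp_pos θ)).ne' hq.ne',
      Real.log_mul hm.ne' (Real.exp_pos θ).ne', Real.log_exp] at h
    have h2 := mul_le_mul_of_nonneg_left h hq.le
    have h3 : q * (m * Real.exp θ / q - 1) = m * Real.exp θ - q := by field_simp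
    rw [h3] at h2
    nlinarith

/-! ### Truncation weights at the threshold γ -/

/-- Truncated inverse of a probability: `c / y` above the threshold `γ` and `0` below it. -/
noncomputable def truncInv (c γ y : ℝ) : ℝ := if γ < y then c / y else 0

/-- Indicator of the probabilities above the threshold `γ`. -/
noncomputable def isCommon (γ y : ℝ) : ℝ := if γ < y then 1 else 0

/-- The weight `min (1, γ / y)`. -/
noncomputable def rareWeight (γ y : ℝ) : ℝ := if y ≤ γ then 1 else γ / y

lemma measurable_truncInv (c γ : ℝ) : Measurable (truncInv c γ) :=
  Measurable.ite measurableSet_Ioi (measurable_const.div measurable_id) measurable_const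

lemma measurable_isCommon (γ : ℝ) : Measurable (isCommon γ) :=
  Measurable.ite measurableSet_Ioi measurable_const measurable_const

lemma measurable_rareWeight (γ : ℝ) : Measurable (rareWeight γ) :=
  Measurable.ite measurableSet_Iic measurable_const (measurable_const.div measurable_id)

lemma truncInv_nonneg {c γ : ℝ} (hc : 0 ≤ c) (hγ : 0 < γ) (y : ℝ) : 0 ≤ truncInv c γ y := by
  unfold truncInv; split_ifs with h
  · exact div_nonneg hc (hγ.trans h).le
  · exact le_rfl

lemma truncInv_le {c γ : ℝ} (hc : 0 ≤ c) (hγ : 0 < γ) (y : ℝ) : truncInv c γ y ≤ c / γ := by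
  unfold truncInv; split_ifs with h
  · gcongr
  · positivity

lemma mul_truncInv {γ : ℝ} (hγ : 0 < γ) (c y : ℝ) : y * truncInv c γ y = c * isCommon γ y := by
  unfold truncInv isCommon; split_ifs with h
  · have := (hγ.trans h).ne'
    field_simp
  · simp

lemma isCommon_mem (γ y : ℝ) : isCommon γ y ∈ Set.Icc (0 : ℝ) 1 := by
  unfold isCommon; split_ifs <;> simp

lemma isCommon_sq (γ y : ℝ) : isCommon γ y ^ 2 = isCommon γ y := by
  unfold isCommon; split_ifs <;> simp

lemma rareWeight_mem {γ : ℝ} (hγ : 0 < γ) (y : ℝ) : rareWeight γ y ∈ Set.Icc (0 : ℝ) 1 := by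
  unfold rareWeight; split_ifs with h
  · simp
  · rw [not_le] at h
    exact ⟨div_nonneg hγ.le (hγ.trans h).le, (div_le_one (hγ.trans h)).2 h.le⟩

lemma mul_rareWeight {γ : ℝ} (hγ : 0 < γ) (y : ℝ) : y * rareWeight γ y = min y γ := by
  unfold rareWeight; split_ifs with h
  · simp [h]
  · rw [not_le] at h
    have := (hγ.trans h).ne'
    rw [min_eq_right h.le]; field_simp

lemma mul_isCommon_le_min {γ : ℝ} (hγ : 0 < γ) {y : ℝ} (hy : 0 ≤ y) :
    γ * isCommon γ y ≤ min y γ := by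
  unfold isCommon; split_ifs with h
  · simp [h.le]
  · simp [hy, hγ.le]

lemma mul_one_sub_isCommon_le_min {γ : ℝ} (hγ : 0 < γ) {y : ℝ} (hy : 0 ≤ y) :
    y * (1 - isCommon γ y) ≤ min y γ := by
  unfold isCommon; split_ifs with h
  · simp [hy, hγ.le]
  · simp [not_lt.1 h]

/-- One-step lower bound for the growth of `y ↦ y log y`. -/
lemma mul_log_step {p q z c γ ε : ℝ} (hp : 0 ≤ p) (hq : 0 ≤ q) (hz : z ∈ Set.Icc (0 : ℝ) 1)
    (hc : 0 ≤ c) (hε : 0 < ε) (hεγ : ε ≤ γ) :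
    p * Real.log p - ε + (q - p) * (Real.log (max p ε) + 1)
      + truncInv c γ p * z * (p - q) - truncInv c γ p ^ 2 * p * z ≤ q * Real.log q := by
  have hγ : 0 < γ := hε.trans_le hεγ
  -- The tangent is taken at m instead of p because log p is unbounded as p tends to 0. This costs
  -- at most ε, and m = p whenever the weight l is nonzero, since ε ≤ γ.
  set m := max p ε with hm
  have hm0 : 0 < m := lt_max_of_lt_right hε
  set l := truncInv c γ p with hl
  have hl0 : 0 ≤ l := truncInv_nonneg hc hγ p
  have h1 := mul_log_fenchel (-(l * z)) hq hm0
  have h2 : m ≤ p + ε := max_le (by linarith) (by linarith)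
  have h3 : p * Real.log p ≤ p * Real.log m := by
    rcases hp.eq_or_lt with h | h
    · simp [← h]
    · exact mul_le_mul_of_nonneg_left (Real.log_le_log h (le_max_left _ _)) hp
  have h4 : m * Real.exp (-(l * z)) ≤ m - l * z * p + l ^ 2 * p * z := by
    have hlz : 0 ≤ l * z := mul_nonneg hl0 hz.1
    by_cases h : γ < p
    · have hmp : m = p := max_eq_left (hεγ.trans h.le)
      have h5 := mul_le_mul_of_nonneg_left (exp_neg_le_quadratic hlz) hp
      have h6 : p * (l * z) ^ 2 ≤ l ^ 2 * p * z := by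
        have : z ^ 2 ≤ z := by nlinarith [hz.1, hz.2]
        have := mul_le_mul_of_nonneg_left this (mul_nonneg hp (sq_nonneg l))
        nlinarith
      rw [hmp]; nlinarith
    · have : l = 0 := by rw [hl]; simp [truncInv, h]
      simp [this]
  nlinarith

/-- Terms in `[0,1]`, summed until their partial sums reach `K`, add up to at most `K + 1`. -/
lemma sum_stopped_le {K : ℝ} (hK : 0 ≤ K) (y : ℕ → ℝ) (hy : ∀ n, y n ∈ Set.Icc (0 : ℝ) 1)
    (n : ℕ) :
    ∑ k ∈ Finset.range n, (if ∑ s ∈ Finset.range k, y s < K then y k else 0) ≤ K + 1 := by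
  suffices h : ∑ k ∈ Finset.range n, (if ∑ s ∈ Finset.range k, y s < K then y k else 0)
      ≤ min (∑ s ∈ Finset.range n, y s) (K + 1) from h.trans (min_le_right _ _)
  induction n with
  | zero => simp; linarith
  | succ n ih =>
    rw [Finset.sum_range_succ, Finset.sum_range_succ _ n]
    have h1 := ih.trans (min_le_left _ _)
    have h2 := ih.trans (min_le_right _ _)
    split_ifs with h
    · exact le_min (by linarith) (by linarith [(hy n).2])
    · exact le_min (by linarith [(hy n).1]) (by linarith)

/-- A minimisation over the learning rate `c`. -/
lemma le_two_sqrt_of_forall {r y a b : ℝ} (ha : 0 ≤ a) (hb : 0 < b)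
    (h : ∀ c, 0 < c → r ≤ y + a / c + c * b) : r ≤ y + 2 * √(a * b) := by
  refine le_of_forall_pos_le_add fun ε hε => ?_
  have hsb : 0 < √b := Real.sqrt_pos.2 hb
  set e := ε / √b with he
  have he0 : 0 < e := div_pos hε hsb
  have hsa : 0 ≤ √a := Real.sqrt_nonneg a
  -- The minimizer √a/√b is not admissible when a = 0; the shift by e keeps c positive and costs ε.
  have h1 := h ((√a + e) / √b) (by positivity)
  have h2 : a / ((√a + e) / √b) ≤ √a * √b := by
    rw [div_le_iff₀ (by positivity)]
    have : √a * √b * ((√a + e) / √b) = √a * √a + √a * e := by field_simp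
    rw [this, Real.mul_self_sqrt ha]
    nlinarith
  have h3 : (√a + e) / √b * b = √a * √b + ε := by
    have hbb : √b * √b = b := Real.mul_self_sqrt hb.le
    have : e * √b = ε := by rw [he]; field_simp
    rw [div_mul_eq_mul_div, div_eq_iff hsb.ne', ← this, ← hbb]
    ring_nf
    rw [Real.sqrt_sq hsb.le]
  rw [Real.sqrt_mul ha]
  linarith

/-! ### Posterior sampling of a single event -/

/-- An event with indicator `A` is sampled from its posterior probability `p n` given the
history `F n`: in round `n < T` it is drawn (with indicator `B n`) independently of the
environment `G n`, and the loss `x n` is then observed if it was drawn. -/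
structure IsPosteriorSampling {Ω : Type*} [m0 : MeasurableSpace Ω] (P : Measure Ω)
    (F G : ℕ → MeasurableSpace Ω) (T : ℕ) (A : Ω → ℝ) (B x p : ℕ → Ω → ℝ) : Prop where
  mono_hist : Monotone F
  mono_env : Monotone G
  hist_le : ∀ n, F n ≤ G n
  env_le : ∀ n, G n ≤ m0
  measurable_event : Measurable[G 0] A
  measurable_loss : ∀ n, Measurable[G 0] (x n)
  measurable_draw : ∀ n, Measurable (B n)
  measurable_obs : ∀ n, Measurable[F (n + 1)] (fun ω => B n ω * x n ω)
  measurable_prob : ∀ n, Measurable[F n] (p n)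
  event_mem : ∀ ω, A ω = 0 ∨ A ω = 1
  draw_mem : ∀ n ω, B n ω = 0 ∨ B n ω = 1
  loss_mem : ∀ n ω, x n ω ∈ Set.Icc (0 : ℝ) 1
  prob_mem : ∀ n ω, p n ω ∈ Set.Icc (0 : ℝ) 1
  integral_event : ∀ n (Y : Ω → ℝ), Measurable[F n] Y → (∃ C, ∀ ω, |Y ω| ≤ C) →
    ∫ ω, A ω * Y ω ∂P = ∫ ω, p n ω * Y ω ∂P
  integral_draw : ∀ n < T, ∀ X : Ω → ℝ, Measurable[G n] X → (∃ C, ∀ ω, |X ω| ≤ C) →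
    ∫ ω, B n ω * X ω ∂P = ∫ ω, p n ω * X ω ∂P

lemma integrable_of_bounded {Ω : Type*} [MeasurableSpace Ω] {P : Measure Ω} [IsFiniteMeasure P]
    {f : Ω → ℝ} (hf : Measurable f) {C : ℝ} (h : ∀ ω, |f ω| ≤ C) : Integrable f P :=
  Integrable.of_bound hf.aestronglyMeasurable C (Filter.Eventually.of_forall h)

lemma abs_le_one_of_mem {y : ℝ} (h : y ∈ Set.Icc (0 : ℝ) 1) : |y| ≤ 1 := by
  rw [abs_of_nonneg h.1]; exact h.2

lemma mul_mem_unit {y z : ℝ} (hy : y ∈ Set.Icc (0 : ℝ) 1) (hz : z ∈ Set.Icc (0 : ℝ) 1) :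
    y * z ∈ Set.Icc (0 : ℝ) 1 :=
  ⟨mul_nonneg hy.1 hz.1, mul_le_one₀ hy.2 hz.1 hz.2⟩

namespace IsPosteriorSampling

variable {Ω : Type*} [m0 : MeasurableSpace Ω] {P : Measure Ω}
  {F G : ℕ → MeasurableSpace Ω} {T : ℕ} {A : Ω → ℝ} {B x p : ℕ → Ω → ℝ}

lemma event_unit (h : IsPosteriorSampling P F G T A B x p) (ω : Ω) :
    A ω ∈ Set.Icc (0 : ℝ) 1 := by
  rcases h.event_mem ω with e | e <;> simp [e]

lemma draw_unit (h : IsPosteriorSampling P F G T A B x p) (n : ℕ) (ω : Ω) :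
    B n ω ∈ Set.Icc (0 : ℝ) 1 := by
  rcases h.draw_mem n ω with e | e <;> simp [e]

lemma hist_le_ambient (h : IsPosteriorSampling P F G T A B x p) (n : ℕ) : F n ≤ m0 :=
  (h.hist_le n).trans (h.env_le n)

/-! ### Weighted observed losses -/

/-- The weighted observed loss in round `n`. -/
noncomputable def obs (γ : ℝ) (B x p : ℕ → Ω → ℝ) (n : ℕ) (ω : Ω) : ℝ :=
  rareWeight γ (p n ω) * (B n ω * x n ω)

/-- The weighted observed loss before round `n`. -/
noncomputable def cumObs (γ : ℝ) (B x p : ℕ → Ω → ℝ) (n : ℕ) (ω : Ω) : ℝ :=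
  ∑ s ∈ Finset.range n, obs γ B x p s ω

lemma measurable_obs' (h : IsPosteriorSampling P F G T A B x p) (γ : ℝ) (n : ℕ) :
    Measurable[F (n + 1)] (obs γ B x p n) :=
  Measurable.mul ((measurable_rareWeight γ).comp
    ((h.measurable_prob n).mono (h.mono_hist n.le_succ) le_rfl)) (h.measurable_obs n)

lemma obs_mem (h : IsPosteriorSampling P F G T A B x p) {γ : ℝ} (hγ : 0 < γ) (n : ℕ) (ω : Ω) :
    obs γ B x p n ω ∈ Set.Icc (0 : ℝ) 1 :=
  mul_mem_unit (rareWeight_mem hγ _) (mul_mem_unit (h.draw_unit n ω) (h.loss_mem n ω))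

lemma cumObs_le (h : IsPosteriorSampling P F G T A B x p) {γ : ℝ} (hγ : 0 < γ) (n : ℕ)
    (ω : Ω) : cumObs γ B x p n ω ≤ n := by
  refine (Finset.sum_le_sum fun s _ => (h.obs_mem hγ s ω).2).trans ?_
  simp

lemma measurable_cumObs (h : IsPosteriorSampling P F G T A B x p) (γ : ℝ) (n : ℕ) :
    Measurable[F n] (cumObs γ B x p n) := by
  refine Finset.measurable_fun_sum _ fun s hs => ?_
  exact (h.measurable_obs' γ s).mono (h.mono_hist (Finset.mem_range.1 hs)) le_rfl

/-! ### Exponential moments and the truncated posterior loss -/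

variable [IsProbabilityMeasure P]

/-- The exponential supermartingale bound for the weighted observed loss. -/
lemma integral_exp_cumObs_sub_le (h : IsPosteriorSampling P F G T A B x p) {γ : ℝ} (hγ : 0 < γ)
    (n : ℕ) (hn : n ≤ T) :
    ∫ ω, Real.exp (cumObs γ B x p n ω - 2 * γ * ∑ s ∈ Finset.range n, x s ω) ∂P ≤ 1 := by
  induction n with
  | zero => simp [cumObs]
  | succ n ih =>
    refine le_trans ?_ (ih (by omega))
    set E : Ω → ℝ := fun ω =>
      Real.exp (cumObs γ B x p n ω - 2 * γ * ∑ s ∈ Finset.range n, x s ω) with hE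
    have hxn : ∀ k, Measurable[G n] (x k) := fun k =>
      (h.measurable_loss k).mono (h.mono_env n.zero_le) le_rfl
    have hpn : Measurable[G n] (p n) := (h.measurable_prob n).mono (h.hist_le n) le_rfl
    have hEm : Measurable[G n] E :=
      Real.measurable_exp.comp (((h.measurable_cumObs γ n).mono (h.hist_le n) le_rfl).sub
        ((Finset.measurable_fun_sum _ fun s _ => hxn s).const_mul _))
    have hEb : ∀ ω, |E ω| ≤ Real.exp n := fun ω => by
      rw [abs_of_pos (Real.exp_pos _)]
      refine Real.exp_le_exp.2 ?_
      have := h.cumObs_le hγ n ω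
      have : 0 ≤ 2 * γ * ∑ s ∈ Finset.range n, x s ω :=
        mul_nonneg (by positivity) (Finset.sum_nonneg fun s _ => (h.loss_mem s ω).1)
      linarith
    -- The compensator of round n is included at once: the whole loss sequence is known to `G n`, so
    -- only the draw `B n` is left to average.
    set D : Ω → ℝ := fun ω => E ω * Real.exp (-(2 * γ * x n ω)) with hD
    have hDm : Measurable[G n] D :=
      hEm.mul (Real.measurable_exp.comp ((hxn n).const_mul _).neg)
    have hDb : ∀ ω, |D ω| ≤ Real.exp n := fun ω => by
      rw [hD, abs_mul, abs_of_pos (Real.exp_pos _), abs_of_pos (Real.exp_pos _)]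
      have h1 := hEb ω
      rw [hE, abs_of_pos (Real.exp_pos _)] at h1
      have h2 : Real.exp (-(2 * γ * x n ω)) ≤ 1 := Real.exp_le_one_iff.2 (by
        have := mul_nonneg hγ.le (h.loss_mem n ω).1; linarith)
      calc _ ≤ Real.exp n * 1 := by gcongr
        _ = _ := mul_one _
    have hD0 : ∀ ω, 0 ≤ D ω := fun ω => mul_nonneg (Real.exp_pos _).le (Real.exp_pos _).le
    set X : Ω → ℝ := fun ω => D ω * (rareWeight γ (p n ω) * x n ω) with hX
    have hwx : ∀ ω, rareWeight γ (p n ω) * x n ω ∈ Set.Icc (0 : ℝ) 1 := fun ω =>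
      mul_mem_unit (rareWeight_mem hγ _) (h.loss_mem n ω)
    have hXm : Measurable[G n] X :=
      hDm.mul (((measurable_rareWeight γ).comp hpn).mul (hxn n))
    have hXb : ∀ ω, |X ω| ≤ Real.exp n := fun ω => by
      rw [hX, abs_mul]
      calc _ ≤ Real.exp n * 1 :=
            mul_le_mul (hDb ω) (abs_le_one_of_mem (hwx ω)) (abs_nonneg _) (Real.exp_pos _).le
        _ = _ := mul_one _
    have hint : ∀ {f g : Ω → ℝ}, Measurable f → Measurable[G n] g → (∀ ω, f ω ∈ Set.Icc (0 : ℝ) 1) →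
        (∀ ω, |g ω| ≤ Real.exp n) → Integrable (fun ω => f ω * g ω) P := by
      intro f g hf hg hf1 hg1
      refine integrable_of_bounded (hf.mul (hg.mono (h.env_le n) le_rfl))
        (C := 1 * Real.exp n) fun ω => ?_
      rw [abs_mul]
      exact mul_le_mul (abs_le_one_of_mem (hf1 ω)) (hg1 ω) (abs_nonneg _) zero_le_one
    have iD : Integrable D P := integrable_of_bounded (hDm.mono (h.env_le n) le_rfl) hDb
    have iE : Integrable E P := integrable_of_bounded (hEm.mono (h.env_le n) le_rfl) hEb
    have iB := hint (h.measurable_draw n) hXm (h.draw_unit n) hXb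
    have ip := hint (hpn.mono (h.env_le n) le_rfl) hXm (h.prob_mem n) hXb
    calc _ ≤ ∫ ω, (D ω + 2 * (B n ω * X ω)) ∂P := by
          refine integral_mono_of_nonneg (Filter.Eventually.of_forall fun ω => (Real.exp_pos _).le)
            (iD.add (iB.const_mul 2)) (Filter.Eventually.of_forall fun ω => ?_)
          have e1 : Real.exp (cumObs γ B x p (n + 1) ω -
              2 * γ * ∑ s ∈ Finset.range (n + 1), x s ω) = D ω * Real.exp (obs γ B x p n ω) := by
            simp only [hD, hE, ← Real.exp_add, cumObs, Finset.sum_range_succ]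
            congr 1; ring
          have e2 := exp_le_one_add_two_mul (h.obs_mem hγ n ω).1 (h.obs_mem hγ n ω).2
          have e3 := mul_le_mul_of_nonneg_left e2 (hD0 ω)
          simp only [e1]
          refine e3.trans (le_of_eq ?_)
          rw [hX, obs]; ring
      _ = ∫ ω, D ω ∂P + 2 * ∫ ω, B n ω * X ω ∂P := by
          rw [integral_add iD (iB.const_mul 2), integral_const_mul]
      _ = ∫ ω, (D ω + 2 * (p n ω * X ω)) ∂P := by
          rw [h.integral_draw n (by omega) X hXm ⟨_, hXb⟩,
            integral_add iD (ip.const_mul 2), integral_const_mul]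
      _ ≤ ∫ ω, E ω ∂P := by
          refine integral_mono (iD.add (ip.const_mul 2)) iE fun ω => ?_
          have hx0 := (h.loss_mem n ω).1
          have e1 : p n ω * X ω ≤ D ω * (γ * x n ω) := by
            have : p n ω * X ω = D ω * (min (p n ω) γ * x n ω) := by
              rw [hX, ← mul_rareWeight hγ]; ring
            rw [this]
            exact mul_le_mul_of_nonneg_left (mul_le_mul_of_nonneg_right (min_le_right _ _) hx0)
              (hD0 ω)
          have e2 : 2 * γ * x n ω + 1 ≤ Real.exp (2 * γ * x n ω) := Real.add_one_le_exp _
          have e3 : D ω * Real.exp (2 * γ * x n ω) = E ω := by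
            rw [hD, mul_assoc, ← Real.exp_add]; simp
          have e4 := mul_le_mul_of_nonneg_left e2 (hD0 ω)
          change D ω + 2 * (p n ω * X ω) ≤ E ω
          nlinarith

/-- Because `cumObs` is determined by the history, p_n may be exchanged for the event itself. On the
event the cumulative loss is at most L, so the compensator in the supermartingale bound is at most
2γL. -/
lemma integral_prob_mul_exp_cumObs_le (h : IsPosteriorSampling P F G T A B x p) {γ L : ℝ}
    (hγ : 0 < γ) (hL : ∀ᵐ ω ∂P, A ω = 1 → ∑ s ∈ Finset.range T, x s ω ≤ L) (n : ℕ)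
    (hn : n ≤ T) :
    ∫ ω, p n ω * Real.exp (cumObs γ B x p n ω) ∂P ≤ Real.exp (2 * γ * L) := by
  have hNm : Measurable[F n] fun ω => Real.exp (cumObs γ B x p n ω) :=
    Real.measurable_exp.comp (h.measurable_cumObs γ n)
  have hNb : ∀ ω, |Real.exp (cumObs γ B x p n ω)| ≤ Real.exp n := fun ω => by
    rw [abs_of_pos (Real.exp_pos _)]; exact Real.exp_le_exp.2 (h.cumObs_le hγ n ω)
  rw [← h.integral_event n _ hNm ⟨_, hNb⟩]
  have hxm : ∀ k, Measurable (x k) := fun k => (h.measurable_loss k).mono (h.env_le 0) le_rfl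
  have hsum : ∀ ω, 0 ≤ ∑ s ∈ Finset.range n, x s ω := fun ω =>
    Finset.sum_nonneg fun s _ => (h.loss_mem s ω).1
  have iE : Integrable (fun ω => Real.exp (cumObs γ B x p n ω -
      2 * γ * ∑ s ∈ Finset.range n, x s ω)) P := by
    refine integrable_of_bounded (C := Real.exp n) (Real.measurable_exp.comp
      (((h.measurable_cumObs γ n).mono (h.hist_le_ambient n) le_rfl).sub
        ((Finset.measurable_fun_sum _ fun s _ => hxm s).const_mul _))) fun ω => ?_
    rw [abs_of_pos (Real.exp_pos _)]
    refine Real.exp_le_exp.2 ?_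
    have := mul_nonneg (mul_nonneg zero_le_two hγ.le) (hsum ω)
    linarith [h.cumObs_le hγ n ω]
  calc _ ≤ ∫ ω, Real.exp (2 * γ * L) * Real.exp (cumObs γ B x p n ω -
        2 * γ * ∑ s ∈ Finset.range n, x s ω) ∂P := by
        refine integral_mono_of_nonneg (Filter.Eventually.of_forall fun ω =>
          mul_nonneg (h.event_unit ω).1 (Real.exp_pos _).le) (iE.const_mul _) ?_
        filter_upwards [hL] with ω hω
        rcases h.event_mem ω with e | e
        · simp only [e, zero_mul]
          positivity
        · simp only [e, one_mul, ← Real.exp_add]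
          refine Real.exp_le_exp.2 ?_
          have h1 : ∑ s ∈ Finset.range n, x s ω ≤ ∑ s ∈ Finset.range T, x s ω :=
            Finset.sum_le_sum_of_subset_of_nonneg (Finset.range_mono hn)
              fun s _ _ => (h.loss_mem s ω).1
          have h2 := mul_le_mul_of_nonneg_left (h1.trans (hω e))
            (mul_nonneg zero_le_two hγ.le)
          linarith
    _ ≤ Real.exp (2 * γ * L) * 1 := by
        rw [integral_const_mul]
        exact mul_le_mul_of_nonneg_left (h.integral_exp_cumObs_sub_le hγ n hn) (Real.exp_pos _).le
    _ = _ := mul_one _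

/-- The truncated posterior loss of the event is at most logarithmic in the horizon. -/
theorem sum_integral_min_le (h : IsPosteriorSampling P F G T A B x p) {γ L : ℝ} (hT : 1 ≤ T)
    (hγ : 0 < γ) (hγL : γ * L = Real.log T)
    (hL : ∀ᵐ ω ∂P, A ω = 1 → ∑ s ∈ Finset.range T, x s ω ≤ L) :
    ∑ n ∈ Finset.range T, ∫ ω, min (p n ω) γ * x n ω ∂P ≤ 3 * Real.log T + 2 := by
  have hT0 : (0 : ℝ) < T := by exact_mod_cast hT
  -- Markov's factor exp(-K) = T⁻³ against exp(2γL) = T² leaves 1/T for each of the T rounds.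
  set K := 3 * Real.log T with hK
  have hK0 : 0 ≤ K := mul_nonneg (by norm_num) (Real.log_natCast_nonneg T)
  -- Lateness depends only on rounds before n, so it can be treated as known when the draw of round
  -- n is averaged.
  set late : ℕ → Ω → ℝ := fun n ω => if cumObs γ B x p n ω < K then 0 else 1 with hlate
  have hlm : ∀ n, Measurable[F n] (late n) := fun n =>
    Measurable.ite (measurableSet_lt (h.measurable_cumObs γ n) measurable_const)
      measurable_const measurable_const
  have hlu : ∀ n ω, late n ω ∈ Set.Icc (0 : ℝ) 1 := fun n ω => by
    simp only [hlate]; split_ifs <;> simp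
  have hxn : ∀ n k, Measurable[G n] (x k) := fun n k =>
    (h.measurable_loss k).mono (h.mono_env n.zero_le) le_rfl
  have hwx : ∀ n ω, rareWeight γ (p n ω) * x n ω ∈ Set.Icc (0 : ℝ) 1 := fun n ω =>
    mul_mem_unit (rareWeight_mem hγ _) (h.loss_mem n ω)
  have hwm : ∀ n, Measurable[G n] fun ω => rareWeight γ (p n ω) * x n ω := fun n =>
    ((measurable_rareWeight γ).comp ((h.measurable_prob n).mono (h.hist_le n) le_rfl)).mul (hxn n n)
  have hom : ∀ n, Measurable (obs γ B x p n) := fun n =>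
    (h.measurable_obs' γ n).mono (h.hist_le_ambient _) le_rfl
  have hlm0 : ∀ n, Measurable (late n) := fun n => (hlm n).mono (h.hist_le_ambient n) le_rfl
  have hpm0 : ∀ n, Measurable (p n) := fun n =>
    (h.measurable_prob n).mono (h.hist_le_ambient n) le_rfl
  have iunit : ∀ {f : Ω → ℝ}, Measurable f → (∀ ω, f ω ∈ Set.Icc (0 : ℝ) 1) → Integrable f P :=
    fun hf hu => integrable_of_bounded hf (C := 1) fun ω => abs_le_one_of_mem (hu ω)
  have e1 : ∀ n ∈ Finset.range T, ∫ ω, min (p n ω) γ * x n ω ∂P =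
      ∫ ω, obs γ B x p n ω ∂P := fun n hn => by
    have := h.integral_draw n (Finset.mem_range.1 hn) _ (hwm n)
      ⟨1, fun ω => abs_le_one_of_mem (hwx n ω)⟩
    calc _ = ∫ ω, p n ω * (rareWeight γ (p n ω) * x n ω) ∂P := by
          congr 1; ext ω; rw [← mul_rareWeight hγ]; ring
      _ = _ := this.symm
      _ = _ := by congr 1; ext ω; rw [obs]; ring
  have e2 : ∀ n ∈ Finset.range T, ∫ ω, late n ω * obs γ B x p n ω ∂P ≤ 1 / T := fun n hn => by
    have hn' := Finset.mem_range.1 hn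
    have := h.integral_draw n hn' (fun ω => late n ω * (rareWeight γ (p n ω) * x n ω))
      (((hlm n).mono (h.hist_le n) le_rfl).mul (hwm n))
      ⟨1, fun ω => abs_le_one_of_mem (mul_mem_unit (hlu n ω) (hwx n ω))⟩
    have hexp : ∫ ω, Real.exp (-K) * (p n ω * Real.exp (cumObs γ B x p n ω)) ∂P ≤ 1 / T := by
      rw [integral_const_mul]
      refine (mul_le_mul_of_nonneg_left (h.integral_prob_mul_exp_cumObs_le hγ hL n hn'.le)
        (Real.exp_pos _).le).trans (le_of_eq ?_)
      rw [← Real.exp_add, show -K + 2 * γ * L = -Real.log T by rw [hK, mul_assoc, hγL]; ring,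
        Real.exp_neg, Real.exp_log hT0, one_div]
    refine le_trans ?_ hexp
    calc ∫ ω, late n ω * obs γ B x p n ω ∂P
        = ∫ ω, B n ω * (late n ω * (rareWeight γ (p n ω) * x n ω)) ∂P := by
          congr 1; ext ω; rw [obs]; ring
      _ = _ := this
      _ ≤ _ := by
        refine integral_mono_of_nonneg (Filter.Eventually.of_forall fun ω =>
          (mul_mem_unit (h.prob_mem n ω) (mul_mem_unit (hlu n ω) (hwx n ω))).1)
          (Integrable.const_mul (integrable_of_bounded (C := 1 * Real.exp n)
            ((hpm0 n).mul (Real.measurable_exp.comp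
              ((h.measurable_cumObs γ n).mono (h.hist_le_ambient n) le_rfl))) fun ω => ?_) _)
          (Filter.Eventually.of_forall fun ω => ?_)
        · change |p n ω * Real.exp (cumObs γ B x p n ω)| ≤ _
          rw [abs_mul, abs_of_pos (Real.exp_pos _)]
          exact mul_le_mul (abs_le_one_of_mem (h.prob_mem n ω))
            (Real.exp_le_exp.2 (h.cumObs_le hγ n ω)) (Real.exp_pos _).le zero_le_one
        · change p n ω * (late n ω * (rareWeight γ (p n ω) * x n ω)) ≤
            Real.exp (-K) * (p n ω * Real.exp (cumObs γ B x p n ω))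
          have h1 : late n ω ≤ Real.exp (-K) * Real.exp (cumObs γ B x p n ω) := by
            simp only [hlate]
            split_ifs with hc
            · positivity
            · rw [← Real.exp_add]
              exact Real.one_le_exp (by linarith)
          calc _ ≤ p n ω * (late n ω * 1) := by
                have := (hwx n ω).2
                have := (h.prob_mem n ω).1
                have := (hlu n ω).1
                gcongr
            _ ≤ p n ω * (Real.exp (-K) * Real.exp (cumObs γ B x p n ω)) := by
                have := (h.prob_mem n ω).1
                rw [mul_one]
                gcongr
            _ = _ := by ring
  have iearly : ∀ n, Integrable (fun ω => (1 - late n ω) * obs γ B x p n ω) P := fun n =>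
    iunit ((measurable_const.sub (hlm0 n)).mul (hom n)) fun ω =>
      mul_mem_unit ⟨by linarith [(hlu n ω).2], by linarith [(hlu n ω).1]⟩ (h.obs_mem hγ n ω)
  have ilate : ∀ n, Integrable (fun ω => late n ω * obs γ B x p n ω) P := fun n =>
    iunit ((hlm0 n).mul (hom n)) fun ω => mul_mem_unit (hlu n ω) (h.obs_mem hγ n ω)
  have e3 : ∑ n ∈ Finset.range T, ∫ ω, (1 - late n ω) * obs γ B x p n ω ∂P ≤ K + 1 := by
    rw [← integral_finsetSum _ fun n _ => iearly n]
    calc _ ≤ ∫ _, (K + 1) ∂P := by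
          refine integral_mono (integrable_finsetSum _ fun n _ => iearly n) (integrable_const _)
            fun ω => ?_
          refine le_trans (le_of_eq (Finset.sum_congr rfl fun n _ => ?_))
            (sum_stopped_le hK0 (fun n => obs γ B x p n ω) (fun n => h.obs_mem hγ n ω) T)
          by_cases hc : cumObs γ B x p n ω < K
          · rw [if_pos (show ∑ s ∈ Finset.range n, obs γ B x p s ω < K from hc)]
            simp [hlate, hc]
          · rw [if_neg (show ¬∑ s ∈ Finset.range n, obs γ B x p s ω < K from hc)]
            simp [hlate, hc]
      _ = K + 1 := by simp
  calc _ = ∑ n ∈ Finset.range T, (∫ ω, (1 - late n ω) * obs γ B x p n ω ∂P +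
        ∫ ω, late n ω * obs γ B x p n ω ∂P) := by
        refine Finset.sum_congr rfl fun n hn => ?_
        rw [e1 n hn, ← integral_add (iearly n) (ilate n)]
        congr 1; ext ω; ring
    _ ≤ (K + 1) + ∑ n ∈ Finset.range T, (1 / T : ℝ) := by
        rw [Finset.sum_add_distrib]
        exact add_le_add e3 (Finset.sum_le_sum e2)
    _ = K + 2 := by
        simp only [Finset.sum_const, Finset.card_range, nsmul_eq_mul]
        field_simp; ring

/-! ### Entropy growth and the regret of one arm -/

/-- The expected value of `p log p` grows in each round by an amount that controls the regret
incurred when the posterior probability is above the threshold `γ`. -/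
lemma integral_mul_log_step (h : IsPosteriorSampling P F G T A B x p) {γ c ε : ℝ} (hc : 0 ≤ c)
    (hε : 0 < ε) (hεγ : ε ≤ γ) {n : ℕ} (hn : n < T) :
    ∫ ω, p n ω * Real.log (p n ω) ∂P - ε
      + c * ∫ ω, isCommon γ (p n ω) * ((p n ω - A ω) * x n ω) ∂P
      - c ^ 2 * ∫ ω, isCommon γ (p n ω) * x n ω ∂P
      ≤ ∫ ω, p (n + 1) ω * Real.log (p (n + 1) ω) ∂P := by
  have hγ : 0 < γ := hε.trans_le hεγ
  have hpm0 : ∀ n, Measurable (p n) := fun n =>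
    (h.measurable_prob n).mono (h.hist_le_ambient n) le_rfl
  have hAm0 : Measurable A := h.measurable_event.mono (h.env_le 0) le_rfl
  have hxn : Measurable[G n] (x n) := (h.measurable_loss n).mono (h.mono_env n.zero_le) le_rfl
  have hAn : Measurable[G n] A := h.measurable_event.mono (h.mono_env n.zero_le) le_rfl
  have hpG : Measurable[G n] (p n) := (h.measurable_prob n).mono (h.hist_le n) le_rfl
  have hpS : Measurable[F (n + 1)] (p n) :=
    (h.measurable_prob n).mono (h.mono_hist n.le_succ) le_rfl
  -- the entropy terms
  obtain ⟨M, hM⟩ : ∃ M, ∀ y ∈ Set.Icc (0 : ℝ) 1, |y * Real.log y| ≤ M := by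
    obtain ⟨M, hM⟩ := isCompact_Icc.exists_bound_of_continuousOn
      (f := fun y : ℝ => y * Real.log y) (s := Set.Icc 0 1) Real.continuous_mul_log.continuousOn
    exact ⟨M, hM⟩
  have iφ : ∀ k, Integrable (fun ω => p k ω * Real.log (p k ω)) P := fun k =>
    integrable_of_bounded (Real.continuous_mul_log.measurable.comp (hpm0 k))
      fun ω => hM _ (h.prob_mem k ω)
  -- the tangent slope
  set Y : Ω → ℝ := fun ω => Real.log (max (p n ω) ε) + 1 with hY
  have hYF : Measurable[F n] Y :=
    (Real.measurable_log.comp ((h.measurable_prob n).max measurable_const)).add_const 1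
  obtain ⟨C, hC⟩ : ∃ C, ∀ ω, |Y ω| ≤ C := by
    refine ⟨|Real.log ε| + max 1 ε + 1, fun ω => ?_⟩
    have h1 : ε ≤ max (p n ω) ε := le_max_right _ _
    have h2 : max (p n ω) ε ≤ max 1 ε := max_le_max (h.prob_mem n ω).2 le_rfl
    have h3 := Real.log_le_log hε h1
    have h4 := Real.log_le_sub_one_of_pos (hε.trans_le h1)
    have h5 := neg_abs_le (Real.log ε)
    have h6 := le_max_left 1 ε
    have h7 := abs_nonneg (Real.log ε)
    exact abs_le.2 ⟨by simp only [hY]; linarith, by simp only [hY]; linarith⟩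
  have iprod : ∀ {f g : Ω → ℝ} {C : ℝ}, Measurable f → (∀ ω, f ω ∈ Set.Icc (0 : ℝ) 1) →
      Measurable g → (∀ ω, |g ω| ≤ C) → Integrable (fun ω => f ω * g ω) P := by
    intro f g C hf hf1 hg hg1
    refine integrable_of_bounded (hf.mul hg) (C := 1 * C) fun ω => ?_
    rw [abs_mul]
    exact mul_le_mul (abs_le_one_of_mem (hf1 ω)) (hg1 ω) (abs_nonneg _) zero_le_one
  have hYm0 : Measurable Y := hYF.mono (h.hist_le_ambient n) le_rfl
  have iY := fun k => iprod (hpm0 k) (h.prob_mem k) hYm0 hC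
  -- The slope is known at time n and both posteriors integrate it like the event, so the linear
  -- term of the tangent vanishes in expectation.
  have eY : ∫ ω, p (n + 1) ω * Y ω ∂P = ∫ ω, p n ω * Y ω ∂P := by
    rw [← h.integral_event (n + 1) Y (hYF.mono (h.mono_hist n.le_succ) le_rfl) ⟨C, hC⟩,
      ← h.integral_event n Y hYF ⟨C, hC⟩]
  -- the information gained from the draw
  set l : Ω → ℝ := fun ω => truncInv c γ (p n ω) with hl
  have hl0 : ∀ ω, 0 ≤ l ω := fun ω => truncInv_nonneg hc hγ _
  have hlb : ∀ ω, |l ω| ≤ c / γ := fun ω => by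
    rw [abs_of_nonneg (hl0 ω)]; exact truncInv_le hc hγ _
  have hlS : Measurable[F (n + 1)] l := (measurable_truncInv c γ).comp hpS
  have hlG : Measurable[G n] l := (measurable_truncInv c γ).comp hpG
  have hzu : ∀ ω, B n ω * x n ω ∈ Set.Icc (0 : ℝ) 1 := fun ω =>
    mul_mem_unit (h.draw_unit n ω) (h.loss_mem n ω)
  set W : Ω → ℝ := fun ω => l ω * (B n ω * x n ω) with hW
  have hWS : Measurable[F (n + 1)] W := hlS.mul (h.measurable_obs n)
  have hWm0 : Measurable W := hWS.mono (h.hist_le_ambient _) le_rfl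
  have hWb : ∀ ω, |W ω| ≤ c / γ * 1 := fun ω => by
    rw [hW, abs_mul]
    exact mul_le_mul (hlb ω) (abs_le_one_of_mem (hzu ω)) (abs_nonneg _)
      ((abs_nonneg _).trans (hlb ω))
  have iW := fun k => iprod (hpm0 k) (h.prob_mem k) hWm0 hWb
  have iWA := iprod hAm0 h.event_unit hWm0 hWb
  -- W is observed by the end of round n, so the new posterior can be replaced by the event. This
  -- brings A into the bound.
  have eW : ∫ ω, p (n + 1) ω * W ω ∂P = ∫ ω, A ω * W ω ∂P :=
    (h.integral_event (n + 1) W hWS ⟨_, hWb⟩).symm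
  have hpA : ∀ ω, |p n ω - A ω| ≤ 1 := fun ω => by
    have h1 := h.prob_mem n ω
    have h2 := h.event_unit ω
    exact abs_le.2 ⟨by linarith [h1.1, h2.2], by linarith [h1.2, h2.1]⟩
  -- Averaging over the draw produces a factor p_n, which cancels the inverse in l and leaves c on
  -- the common rounds.
  have eR : ∫ ω, p n ω * W ω ∂P - ∫ ω, A ω * W ω ∂P =
      c * ∫ ω, isCommon γ (p n ω) * ((p n ω - A ω) * x n ω) ∂P := by
    have hb : ∀ ω, |l ω * ((p n ω - A ω) * x n ω)| ≤ c / γ * (1 * 1) := fun ω => by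
      rw [abs_mul, abs_mul]
      exact mul_le_mul (hlb ω) (mul_le_mul (hpA ω) (abs_le_one_of_mem (h.loss_mem n ω))
        (abs_nonneg _) zero_le_one) (by positivity) ((abs_nonneg _).trans (hlb ω))
    have := h.integral_draw n hn (fun ω => l ω * ((p n ω - A ω) * x n ω))
      (hlG.mul ((hpG.sub hAn).mul hxn)) ⟨_, hb⟩
    rw [← integral_sub (iW n) iWA, ← integral_const_mul]
    calc _ = ∫ ω, B n ω * (l ω * ((p n ω - A ω) * x n ω)) ∂P := by
          congr 1; ext ω; rw [hW]; ring
      _ = _ := this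
      _ = _ := by
        congr 1; ext ω
        rw [← mul_assoc, ← mul_assoc c, hl, mul_truncInv hγ]
  have hQb : ∀ ω, |l ω ^ 2 * p n ω * x n ω| ≤ (c / γ) ^ 2 * 1 * 1 := fun ω => by
    rw [abs_mul, abs_mul, abs_pow]
    exact mul_le_mul (mul_le_mul (pow_le_pow_left₀ (abs_nonneg _) (hlb ω) 2)
      (abs_le_one_of_mem (h.prob_mem n ω)) (abs_nonneg _) (by positivity))
      (abs_le_one_of_mem (h.loss_mem n ω)) (abs_nonneg _) (by positivity)
  have hQG : Measurable[G n] fun ω => l ω ^ 2 * p n ω * x n ω :=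
    ((hlG.pow_const 2).mul hpG).mul hxn
  have iQ := iprod (h.measurable_draw n) (h.draw_unit n) (hQG.mono (h.env_le n) le_rfl) hQb
  have eQ : ∫ ω, B n ω * (l ω ^ 2 * p n ω * x n ω) ∂P =
      c ^ 2 * ∫ ω, isCommon γ (p n ω) * x n ω ∂P := by
    rw [h.integral_draw n hn _ hQG ⟨_, hQb⟩, ← integral_const_mul]
    congr 1; ext ω
    have e : p n ω * l ω = c * isCommon γ (p n ω) := mul_truncInv hγ _ _
    have e2 := isCommon_sq γ (p n ω)
    calc _ = (p n ω * l ω) ^ 2 * x n ω := by ring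
      _ = c ^ 2 * (isCommon γ (p n ω) ^ 2 * x n ω) := by rw [e]; ring
      _ = _ := by rw [e2]
  have i1 : Integrable (fun ω => p n ω * Real.log (p n ω) - ε) P :=
    (iφ n).sub (integrable_const ε)
  have i2 : Integrable (fun ω => p (n + 1) ω * Y ω - p n ω * Y ω) P := (iY (n + 1)).sub (iY n)
  have i3 : Integrable (fun ω => p n ω * W ω - p (n + 1) ω * W ω) P := (iW n).sub (iW (n + 1))
  have i12 : Integrable (fun ω => p n ω * Real.log (p n ω) - ε +
      (p (n + 1) ω * Y ω - p n ω * Y ω)) P := i1.add i2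
  have i123 : Integrable (fun ω => p n ω * Real.log (p n ω) - ε +
      (p (n + 1) ω * Y ω - p n ω * Y ω) + (p n ω * W ω - p (n + 1) ω * W ω)) P := i12.add i3
  have key : ∫ ω, (p n ω * Real.log (p n ω) - ε + (p (n + 1) ω * Y ω - p n ω * Y ω)
      + (p n ω * W ω - p (n + 1) ω * W ω) - B n ω * (l ω ^ 2 * p n ω * x n ω)) ∂P ≤
      ∫ ω, p (n + 1) ω * Real.log (p (n + 1) ω) ∂P := by
    refine integral_mono (i123.sub iQ) (iφ (n + 1)) fun ω => ?_
    have := mul_log_step (h.prob_mem n ω).1 (h.prob_mem (n + 1) ω).1 (hzu ω) hc hε hεγ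
    refine le_trans (le_of_eq ?_) this
    simp only [hY, hW, hl]
    ring
  rw [integral_sub i123 iQ, integral_add i12 i3, integral_add i1 i2,
    integral_sub (iφ n) (integrable_const ε), integral_sub (iY (n + 1)) (iY n),
    integral_sub (iW n) (iW (n + 1)), eY, eW, eR, eQ] at key
  simpa using key

/-- The regret due to a single arm, in terms of the truncated posterior loss `S` and the prior
probability `r` of the event. -/
theorem sum_integral_regret_le (h : IsPosteriorSampling P F G T A B x p) {γ c S r : ℝ}
    (hγ : 0 < γ) (hc : 0 < c) (hr : ∀ᵐ ω ∂P, p 0 ω = r)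
    (hS : ∑ n ∈ Finset.range T, ∫ ω, min (p n ω) γ * x n ω ∂P ≤ S) :
    ∑ n ∈ Finset.range T, ∫ ω, (p n ω - A ω) * x n ω ∂P ≤
      S + Real.negMulLog r / c + c * (S / γ) := by
  have hpm0 : ∀ n, Measurable (p n) := fun n =>
    (h.measurable_prob n).mono (h.hist_le_ambient n) le_rfl
  have hxm0 : ∀ n, Measurable (x n) := fun n => (h.measurable_loss n).mono (h.env_le 0) le_rfl
  have hAm0 : Measurable A := h.measurable_event.mono (h.env_le 0) le_rfl
  have hcm0 : ∀ n, Measurable fun ω => isCommon γ (p n ω) := fun n =>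
    (measurable_isCommon γ).comp (hpm0 n)
  have hpA : ∀ n ω, |p n ω - A ω| ≤ 1 := fun n ω => by
    have h1 := h.prob_mem n ω
    have h2 := h.event_unit ω
    exact abs_le.2 ⟨by linarith [h1.1, h2.2], by linarith [h1.2, h2.1]⟩
  have hpAx : ∀ n ω, |(p n ω - A ω) * x n ω| ≤ 1 := fun n ω => by
    rw [abs_mul]
    exact mul_le_one₀ (hpA n ω) (abs_nonneg _) (abs_le_one_of_mem (h.loss_mem n ω))
  have hmu : ∀ n ω, min (p n ω) γ * x n ω ∈ Set.Icc (0 : ℝ) 1 := fun n ω =>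
    mul_mem_unit ⟨le_min (h.prob_mem n ω).1 hγ.le, (min_le_left _ _).trans (h.prob_mem n ω).2⟩
      (h.loss_mem n ω)
  have imin : ∀ n, Integrable (fun ω => min (p n ω) γ * x n ω) P := fun n =>
    integrable_of_bounded (((hpm0 n).min measurable_const).mul (hxm0 n)) (C := 1)
      fun ω => abs_le_one_of_mem (hmu n ω)
  have ireg : ∀ n, Integrable (fun ω => (p n ω - A ω) * x n ω) P := fun n =>
    integrable_of_bounded (((hpm0 n).sub hAm0).mul (hxm0 n)) (hpAx n)
  have icom : ∀ n, Integrable (fun ω => isCommon γ (p n ω) * ((p n ω - A ω) * x n ω)) P := fun n =>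
    integrable_of_bounded ((hcm0 n).mul (((hpm0 n).sub hAm0).mul (hxm0 n))) (C := 1) fun ω => by
      rw [abs_mul]
      exact mul_le_one₀ (abs_le_one_of_mem (isCommon_mem _ _)) (abs_nonneg _) (hpAx n ω)
  have icx : ∀ n, Integrable (fun ω => isCommon γ (p n ω) * x n ω) P := fun n =>
    integrable_of_bounded ((hcm0 n).mul (hxm0 n)) (C := 1) fun ω =>
      abs_le_one_of_mem (mul_mem_unit (isCommon_mem _ _) (h.loss_mem n ω))
  -- On rare rounds A is simply dropped, leaving p_n x_n, which is the truncated loss.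
  have e1 : ∀ n, ∫ ω, (p n ω - A ω) * x n ω ∂P ≤ ∫ ω, min (p n ω) γ * x n ω ∂P +
      ∫ ω, isCommon γ (p n ω) * ((p n ω - A ω) * x n ω) ∂P := fun n => by
    rw [← integral_add (imin n) (icom n)]
    refine integral_mono (ireg n) ((imin n).add (icom n)) fun ω => ?_
    have a1 := mul_one_sub_isCommon_le_min hγ (h.prob_mem n ω).1
    have a2 := mul_le_mul_of_nonneg_right a1 (h.loss_mem n ω).1
    have a3 : 0 ≤ (1 - isCommon γ (p n ω)) * (A ω * x n ω) :=
      mul_nonneg (by linarith [(isCommon_mem γ (p n ω)).2])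
        (mul_nonneg (h.event_unit ω).1 (h.loss_mem n ω).1)
    change (p n ω - A ω) * x n ω ≤ min (p n ω) γ * x n ω +
      isCommon γ (p n ω) * ((p n ω - A ω) * x n ω)
    nlinarith
  have e2 : ∀ n, ∫ ω, isCommon γ (p n ω) * x n ω ∂P ≤
      (∫ ω, min (p n ω) γ * x n ω ∂P) / γ := fun n => by
    rw [le_div_iff₀ hγ, mul_comm, ← integral_const_mul]
    refine integral_mono ((icx n).const_mul γ) (imin n) fun ω => ?_
    have := mul_le_mul_of_nonneg_right (mul_isCommon_le_min hγ (h.prob_mem n ω).1)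
      (h.loss_mem n ω).1
    change γ * (isCommon γ (p n ω) * x n ω) ≤ min (p n ω) γ * x n ω
    linarith
  set R := ∑ n ∈ Finset.range T, ∫ ω, isCommon γ (p n ω) * ((p n ω - A ω) * x n ω) ∂P with hR
  have e3 : ∑ n ∈ Finset.range T, ∫ ω, isCommon γ (p n ω) * x n ω ∂P ≤ S / γ := by
    refine (Finset.sum_le_sum fun n _ => e2 n).trans ?_
    rw [← Finset.sum_div]
    gcongr
  -- The entropy steps telescope, from minus the prior term to a nonpositive final value. The
  -- smoothing error ε accumulates T times and is sent to 0 afterwards.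
  have e4 : ∀ ε, 0 < ε → ε ≤ γ → c * R ≤ Real.negMulLog r + c ^ 2 * (S / γ) + T * ε := by
    intro ε hε hεγ
    have s1 : ∑ n ∈ Finset.range T, (c * ∫ ω, isCommon γ (p n ω) * ((p n ω - A ω) * x n ω) ∂P
        - c ^ 2 * ∫ ω, isCommon γ (p n ω) * x n ω ∂P - ε) ≤
        ∑ n ∈ Finset.range T, (∫ ω, p (n + 1) ω * Real.log (p (n + 1) ω) ∂P -
          ∫ ω, p n ω * Real.log (p n ω) ∂P) :=
      Finset.sum_le_sum fun n hn => by
        have := h.integral_mul_log_step hc.le hε hεγ (Finset.mem_range.1 hn)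
        linarith
    rw [Finset.sum_range_sub (fun n => ∫ ω, p n ω * Real.log (p n ω) ∂P),
      Finset.sum_sub_distrib, Finset.sum_sub_distrib, ← Finset.mul_sum, ← Finset.mul_sum] at s1
    have s2 : ∫ ω, p T ω * Real.log (p T ω) ∂P ≤ 0 :=
      integral_nonpos fun ω => Real.mul_log_nonpos (h.prob_mem T ω).1 (h.prob_mem T ω).2
    have s3 : ∫ ω, p 0 ω * Real.log (p 0 ω) ∂P = -Real.negMulLog r := by
      have : (fun ω => p 0 ω * Real.log (p 0 ω)) =ᵐ[P] fun _ => r * Real.log r := by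
        filter_upwards [hr] with ω hω
        rw [hω]
      rw [integral_congr_ae this]
      simp [Real.negMulLog]
    have s4 := mul_le_mul_of_nonneg_left e3 (sq_nonneg c)
    simp only [Finset.sum_const, Finset.card_range, nsmul_eq_mul] at s1
    linarith
  have e5 : c * R ≤ Real.negMulLog r + c ^ 2 * (S / γ) := by
    refine le_of_forall_pos_le_add fun δ hδ => ?_
    have hT1 : (0 : ℝ) < T + 1 := by positivity
    have hm : 0 < min γ (δ / (T + 1)) := lt_min hγ (by positivity)
    refine (e4 _ hm (min_le_left _ _)).trans ?_
    have : (T : ℝ) * min γ (δ / (T + 1)) ≤ (T + 1) * (δ / (T + 1)) :=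
      mul_le_mul (by linarith) (min_le_right _ _) hm.le hT1.le
    rw [mul_div_cancel₀ _ hT1.ne'] at this
    linarith
  have e6 : R ≤ Real.negMulLog r / c + c * (S / γ) := by
    have : Real.negMulLog r / c + c * (S / γ) =
        (Real.negMulLog r + c ^ 2 * (S / γ)) / c := by field_simp
    rw [this, le_div_iff₀ hc]
    linarith
  calc _ ≤ ∑ n ∈ Finset.range T, (∫ ω, min (p n ω) γ * x n ω ∂P +
      ∫ ω, isCommon γ (p n ω) * ((p n ω - A ω) * x n ω) ∂P) := Finset.sum_le_sum fun n _ => e1 n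
    _ ≤ S + R := by rw [Finset.sum_add_distrib]; linarith
    _ ≤ _ := by linarith

end IsPosteriorSampling

/-! ### The bandit model -/

/-- Pulling the known factor X out of the conditional expectation. This turns both the posterior and
the Thompson condition into the integral identities of `IsPosteriorSampling`. -/
lemma integral_indicator_mul_of_condProb {Ω : Type*} {m m0 : MeasurableSpace Ω} {P : Measure Ω}
    [IsProbabilityMeasure P] (hm : m ≤ m0) {S : Set Ω} (hS : MeasurableSet S) {q X : Ω → ℝ}
    (hq : P⟦S | m⟧ =ᵐ[P] q) (hX : Measurable[m] X) (hb : ∃ C, ∀ ω, |X ω| ≤ C) :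
    ∫ ω, S.indicator (fun _ => (1 : ℝ)) ω * X ω ∂P = ∫ ω, q ω * X ω ∂P := by
  obtain ⟨C, hC⟩ := hb
  have hind : Measurable (S.indicator fun _ => (1 : ℝ)) := measurable_const.indicator hS
  have hi : ∀ ω, S.indicator (fun _ => (1 : ℝ)) ω ∈ Set.Icc (0 : ℝ) 1 := fun ω => by
    by_cases h : ω ∈ S <;> simp [h]
  have i1 : Integrable (S.indicator fun _ => (1 : ℝ)) P :=
    integrable_of_bounded hind fun ω => abs_le_one_of_mem (hi ω)
  have i2 : Integrable ((S.indicator fun _ => (1 : ℝ)) * X) P := by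
    refine integrable_of_bounded (hind.mul (hX.mono hm le_rfl)) (C := 1 * C) fun ω => ?_
    rw [Pi.mul_apply, abs_mul]
    exact mul_le_mul (abs_le_one_of_mem (hi ω)) (hC ω) (abs_nonneg _) zero_le_one
  have h1 := condExp_mul_of_stronglyMeasurable_right hX.stronglyMeasurable i2 i1
  calc _ = ∫ ω, ((S.indicator fun _ => (1 : ℝ)) * X) ω ∂P := rfl
    _ = ∫ ω, (P[(S.indicator fun _ => (1 : ℝ)) * X | m]) ω ∂P := (integral_condExp hm).symm
    _ = _ := by
      refine integral_congr_ae ?_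
      filter_upwards [h1, hq] with ω h1 h2
      rw [h1, Pi.mul_apply, h2]

/-! ### σ-algebras and sequences indexed by natural numbers -/

variable {Ω : Type*} {T d : ℕ}

/-- The σ-algebra of the bandit feedback of the rounds before `n`, for any natural number `n`. -/
@[reducible] def histBefore (loss : Fin T → Fin d → Ω → ℝ) (act : Fin T → Ω → Fin d) (n : ℕ) :
    MeasurableSpace Ω :=
  ⨆ s : {s : Fin T // (s : ℕ) < n},
    MeasurableSpace.comap (fun ω => (act s ω, loss s (act s ω) ω)) inferInstance

/-- The σ-algebra of the losses, the optimal arm and the arms played before round `n`. -/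
@[reducible] def envBefore (loss : Fin T → Fin d → Ω → ℝ) (best : Ω → Fin d)
    (act : Fin T → Ω → Fin d) (n : ℕ) : MeasurableSpace Ω :=
  MeasurableSpace.comap (fun ω => ((fun t i => loss t i ω : Fin T → Fin d → ℝ), best ω))
      inferInstance
    ⊔ ⨆ s : {s : Fin T // (s : ℕ) < n}, MeasurableSpace.comap (act s) inferInstance

/-- The losses of an arm, extended by `0` after the last round. -/
noncomputable def lossSeq (loss : Fin T → Fin d → Ω → ℝ) (i : Fin d) (n : ℕ) (ω : Ω) : ℝ :=
  if h : n < T then loss ⟨n, h⟩ i ω else 0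

/-- The indicator of playing an arm, extended by `0` after the last round. -/
noncomputable def drawSeq (act : Fin T → Ω → Fin d) (i : Fin d) (n : ℕ) (ω : Ω) : ℝ :=
  if h : n < T then (act ⟨n, h⟩ ⁻¹' {i}).indicator (fun _ => 1) ω else 0

/-- The indicator that an arm is the optimal one. -/
noncomputable def bestInd (best : Ω → Fin d) (i : Fin d) (ω : Ω) : ℝ :=
  (best ⁻¹' {i}).indicator (fun _ => 1) ω

/-- A version with values in `[0,1]` of the posterior probability of an arm. -/
noncomputable def posterior [MeasurableSpace Ω] (P : Measure Ω) (loss : Fin T → Fin d → Ω → ℝ)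
    (best : Ω → Fin d) (act : Fin T → Ω → Fin d) (i : Fin d) (n : ℕ) (ω : Ω) : ℝ :=
  max 0 (min 1 ((P⟦best ⁻¹' {i} | histBefore loss act n⟧) ω))

lemma envBefore_mono (loss : Fin T → Fin d → Ω → ℝ) (best : Ω → Fin d)
    (act : Fin T → Ω → Fin d) : Monotone (envBefore loss best act) := by
  intro k n hkn
  refine sup_le_sup_left (iSup_le fun s => ?_) _
  exact le_iSup_of_le ⟨s.1, lt_of_lt_of_le s.2 hkn⟩ le_rfl

lemma histBefore_mono (loss : Fin T → Fin d → Ω → ℝ) (act : Fin T → Ω → Fin d) :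
    Monotone (histBefore loss act) := by
  intro k n hkn
  refine iSup_le fun s => ?_
  exact le_iSup_of_le ⟨s.1, lt_of_lt_of_le s.2 hkn⟩ le_rfl

lemma histBefore_zero (loss : Fin T → Fin d → Ω → ℝ) (act : Fin T → Ω → Fin d) :
    histBefore loss act 0 = ⊥ := by
  refine le_bot_iff.1 (iSup_le fun s => absurd s.2 (Nat.not_lt_zero _))

lemma measurable_envBefore_pair (loss : Fin T → Fin d → Ω → ℝ) (best : Ω → Fin d)
    (act : Fin T → Ω → Fin d) (n : ℕ) :
    Measurable[envBefore loss best act n]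
      (fun ω => ((fun t i => loss t i ω : Fin T → Fin d → ℝ), best ω)) :=
  measurable_iff_comap_le.2 le_sup_left

lemma measurable_envBefore_loss (loss : Fin T → Fin d → Ω → ℝ) (best : Ω → Fin d)
    (act : Fin T → Ω → Fin d) (n : ℕ) (t : Fin T) (i : Fin d) :
    Measurable[envBefore loss best act n] (loss t i) :=
  (show Measurable fun z : (Fin T → Fin d → ℝ) × Fin d => z.1 t i from
    (measurable_pi_apply i).comp ((measurable_pi_apply t).comp measurable_fst)).comp
    (measurable_envBefore_pair loss best act n)

lemma measurable_envBefore_best (loss : Fin T → Fin d → Ω → ℝ) (best : Ω → Fin d)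
    (act : Fin T → Ω → Fin d) (n : ℕ) : Measurable[envBefore loss best act n] best :=
  measurable_snd.comp (measurable_envBefore_pair loss best act n)

lemma measurable_envBefore_act (loss : Fin T → Fin d → Ω → ℝ) (best : Ω → Fin d)
    (act : Fin T → Ω → Fin d) {n : ℕ} (s : Fin T) (hs : (s : ℕ) < n) :
    Measurable[envBefore loss best act n] (act s) :=
  measurable_iff_comap_le.2 ((le_iSup (fun s : {s : Fin T // (s : ℕ) < n} =>
    MeasurableSpace.comap (act s) inferInstance) ⟨s, hs⟩).trans le_sup_right)

lemma measurable_histBefore_obs (loss : Fin T → Fin d → Ω → ℝ) (act : Fin T → Ω → Fin d)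
    {n : ℕ} (s : Fin T) (hs : (s : ℕ) < n) :
    Measurable[histBefore loss act n] (fun ω => (act s ω, loss s (act s ω) ω)) :=
  measurable_iff_comap_le.2 (le_iSup (fun s : {s : Fin T // (s : ℕ) < n} =>
    MeasurableSpace.comap (fun ω => (act s ω, loss s (act s ω) ω)) inferInstance) ⟨s, hs⟩)

lemma measurable_selected {m : MeasurableSpace Ω} {f : Fin d → Ω → ℝ} {a : Ω → Fin d}
    (hf : ∀ i, Measurable (f i)) (ha : Measurable a) : Measurable fun ω => f (a ω) ω := by
  have : (fun ω => f (a ω) ω) = fun ω => ∑ i, if a ω = i then f i ω else 0 := by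
    ext ω; simp
  rw [this]
  exact Finset.measurable_fun_sum _ fun i _ =>
    Measurable.ite (ha (measurableSet_singleton i)) (hf i) measurable_const

/-- The environment contains all losses and the past arms, hence also the losses selected by those
arms. -/
lemma histBefore_le_envBefore (loss : Fin T → Fin d → Ω → ℝ) (best : Ω → Fin d)
    (act : Fin T → Ω → Fin d) (n : ℕ) : histBefore loss act n ≤ envBefore loss best act n :=
  iSup_le fun s => by
    have ha := measurable_envBefore_act loss best act s.1 s.2
    exact measurable_iff_comap_le.1 (ha.prodMk
      (measurable_selected (measurable_envBefore_loss loss best act n s.1) ha))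

lemma lossSeq_coe (loss : Fin T → Fin d → Ω → ℝ) (i : Fin d) (t : Fin T) :
    lossSeq loss i t = loss t i := by
  ext ω; simp [lossSeq]

lemma drawSeq_coe (act : Fin T → Ω → Fin d) (i : Fin d) (t : Fin T) :
    drawSeq act i t = (act t ⁻¹' {i}).indicator (fun _ => 1) := by
  ext ω; simp [drawSeq]

lemma bestLoss_eq {loss : Fin T → Fin d → Ω → ℝ} {best : Ω → Fin d}
    (h : ∀ i ω, armLoss loss (best ω) ω ≤ armLoss loss i ω) (ω : Ω) :
    bestLoss loss ω = armLoss loss (best ω) ω := by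
  have : Nonempty (Fin d) := ⟨best ω⟩
  exact le_antisymm (ciInf_le (Set.finite_range _).bddBelow _) (le_ciInf fun i => h i ω)

lemma sum_lossSeq (loss : Fin T → Fin d → Ω → ℝ) (i : Fin d) (ω : Ω) :
    ∑ s ∈ Finset.range T, lossSeq loss i s ω = armLoss loss i ω := by
  rw [Finset.sum_range]
  exact Finset.sum_congr rfl fun t _ => by rw [lossSeq_coe]

lemma regret_eq {loss : Fin T → Fin d → Ω → ℝ} {best : Ω → Fin d} {act : Fin T → Ω → Fin d}
    (h : ∀ ω i, armLoss loss (best ω) ω ≤ armLoss loss i ω) (ω : Ω) :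
    regret loss act ω = ∑ i, ∑ n ∈ Finset.range T,
      (drawSeq act i n ω * lossSeq loss i n ω - bestInd best i ω * lossSeq loss i n ω) := by
  rw [regret, bestLoss_eq (fun i ω => h ω i), armLoss, ← Finset.sum_sub_distrib, Finset.sum_comm,
    Finset.sum_range]
  refine Finset.sum_congr rfl fun t _ => ?_
  simp only [lossSeq_coe, drawSeq_coe, bestInd, Finset.sum_sub_distrib]
  have hsel : ∀ a : Fin d, loss t a ω =
      ∑ i, (if a = i then (1 : ℝ) else 0) * loss t i ω := fun a => by simp
  have hind : ∀ (a : Ω → Fin d) i, (a ⁻¹' {i}).indicator (fun _ => (1 : ℝ)) ω =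
      if a ω = i then 1 else 0 := fun a i => by
    by_cases hi : a ω = i <;> simp [hi]
  rw [hsel (act t ω), hsel (best ω)]
  simp only [hind]

variable [m0 : MeasurableSpace Ω] {P : Measure Ω} [IsProbabilityMeasure P]
  {loss : Fin T → Fin d → Ω → ℝ} {best : Ω → Fin d} {act : Fin T → Ω → Fin d}

lemma envBefore_le (hl : ∀ t i, Measurable (loss t i)) (hb : Measurable best)
    (ha : ∀ t, Measurable (act t)) (n : ℕ) : envBefore loss best act n ≤ m0 :=
  sup_le (measurable_iff_comap_le.1 ((measurable_pi_lambda _ fun t =>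
    measurable_pi_lambda _ fun i => hl t i).prodMk hb))
    (iSup_le fun s => measurable_iff_comap_le.1 (ha s))

/-- A conditional probability lies in [0,1] almost surely, so clamping changes it only on a null
set. If the history is not a sub-σ-algebra, the conditional expectation is 0 by convention and
clamping fixes 0. -/
lemma posterior_ae_eq (hb : Measurable best) (i : Fin d) (n : ℕ) :
    P⟦best ⁻¹' {i} | histBefore loss act n⟧ =ᵐ[P] posterior P loss best act i n := by
  have hS : MeasurableSet (best ⁻¹' {i}) := hb (measurableSet_singleton i)
  have hi : Integrable ((best ⁻¹' {i}).indicator fun _ => (1 : ℝ)) P :=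
    (integrable_const _).indicator hS
  by_cases hm : histBefore loss act n ≤ m0
  · have h0 : 0 ≤ᵐ[P] P⟦best ⁻¹' {i} | histBefore loss act n⟧ :=
      condExp_nonneg (Filter.Eventually.of_forall fun ω =>
        Set.indicator_nonneg (fun _ _ => zero_le_one) ω)
    have h1 : P⟦best ⁻¹' {i} | histBefore loss act n⟧ ≤ᵐ[P]
        P[fun _ => (1 : ℝ) | histBefore loss act n] :=
      condExp_mono hi (integrable_const _) (Filter.Eventually.of_forall fun ω =>
        Set.indicator_le_self' (fun _ _ => zero_le_one) ω)
    rw [condExp_const hm] at h1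
    filter_upwards [h0, h1] with ω h0 h1
    rw [posterior, min_eq_right h1]
    exact (max_eq_right h0).symm
  · refine Filter.Eventually.of_forall fun ω => ?_
    simp [posterior, condExp_of_not_le hm]

lemma isPosteriorSampling (hbandit : IsBayesianBandit loss best)
    (hts : IsThompsonSampling P loss best act) (i : Fin d) :
    IsPosteriorSampling P (histBefore loss act) (envBefore loss best act) T (bestInd best i)
      (drawSeq act i) (lossSeq loss i) (posterior P loss best act i) := by
  have hG := envBefore_le hbandit.measurable_loss hbandit.measurable_best hts.measurable_act
  have hFG := histBefore_le_envBefore loss best act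
  refine
    { mono_hist := histBefore_mono loss act
      mono_env := envBefore_mono loss best act
      hist_le := hFG
      env_le := hG
      measurable_event := measurable_const.indicator
        (measurable_envBefore_best loss best act 0 (measurableSet_singleton i))
      measurable_loss := fun n => ?_
      measurable_draw := fun n => ?_
      measurable_obs := fun n => ?_
      measurable_prob := fun n =>
        measurable_const.max (measurable_const.min stronglyMeasurable_condExp.measurable)
      event_mem := fun ω => ?_
      draw_mem := fun n ω => ?_
      loss_mem := fun n ω => ?_
      prob_mem := fun n ω => ⟨le_max_left _ _, max_le zero_le_one (min_le_left _ _)⟩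
      integral_event := fun n Y hY hYb => ?_
      integral_draw := fun n hn X hX hXb => ?_ }
  · by_cases hn : n < T
    · rw [show lossSeq loss i n = loss ⟨n, hn⟩ i from lossSeq_coe loss i ⟨n, hn⟩]
      exact measurable_envBefore_loss loss best act 0 _ i
    · rw [show lossSeq loss i n = fun _ => 0 by ext ω; simp [lossSeq, hn]]
      exact measurable_const
  · by_cases hn : n < T
    · rw [show drawSeq act i n = _ from drawSeq_coe act i ⟨n, hn⟩]
      exact measurable_const.indicator (hts.measurable_act _ (measurableSet_singleton i))
    · rw [show drawSeq act i n = fun _ => 0 by ext ω; simp [drawSeq, hn]]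
      exact measurable_const
  · by_cases hn : n < T
    · have hg : Measurable fun z : Fin d × ℝ => if z.1 = i then z.2 else 0 :=
        Measurable.ite (measurable_fst (measurableSet_singleton i)) measurable_snd measurable_const
      have := hg.comp (measurable_histBefore_obs loss act (n := n + 1) ⟨n, hn⟩ n.lt_succ_self)
      convert this using 1
      ext ω
      by_cases ha : act ⟨n, hn⟩ ω = i <;> simp [drawSeq, lossSeq, hn, ha]
    · rw [show (fun ω => drawSeq act i n ω * lossSeq loss i n ω) = fun _ => 0 by
        ext ω; simp [drawSeq, hn]]
      exact measurable_const
  · by_cases h : best ω = i <;> simp [bestInd, h]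
  · by_cases hn : n < T
    · by_cases h : act ⟨n, hn⟩ ω = i <;> simp [drawSeq, hn, h]
    · simp [drawSeq, hn]
  · by_cases hn : n < T
    · simpa [lossSeq, hn] using hbandit.loss_mem ⟨n, hn⟩ i ω
    · simp [lossSeq, hn]
  · exact integral_indicator_mul_of_condProb ((hFG n).trans (hG n))
      (hbandit.measurable_best (measurableSet_singleton i))
      (posterior_ae_eq hbandit.measurable_best i n) hY hYb
  · rw [show drawSeq act i n = _ from drawSeq_coe act i ⟨n, hn⟩]
    exact integral_indicator_mul_of_condProb (hG n)
      (hts.measurable_act _ (measurableSet_singleton i))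
      -- The history of round ⟨n, hn⟩ and `histBefore` at n agree definitionally, as the order on
      -- `Fin T` is that of the underlying numbers.
      ((hts.condProb_act ⟨n, hn⟩ i).trans (posterior_ae_eq hbandit.measurable_best i n)) hX hXb

lemma posterior_zero (hb : Measurable best) (i : Fin d) :
    ∀ᵐ ω ∂P, posterior P loss best act i 0 ω = P.real (best ⁻¹' {i}) := by
  filter_upwards [posterior_ae_eq (P := P) (loss := loss) (act := act) hb i 0] with ω h
  rw [← h, histBefore_zero, condExp_bot]
  exact integral_indicator_one (hb (measurableSet_singleton i))

/-- Fresh randomness replaces each draw by p_n. The optimal-arm indicator stays, since it is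
correlated with the losses. -/
lemma integral_regret_eq (hbandit : IsBayesianBandit loss best)
    (hts : IsThompsonSampling P loss best act) :
    ∫ ω, regret loss act ω ∂P = ∑ i, ∑ n ∈ Finset.range T,
      ∫ ω, (posterior P loss best act i n ω - bestInd best i ω) * lossSeq loss i n ω ∂P := by
  have hs := fun i => isPosteriorSampling hbandit hts i
  have hx0 : ∀ i n, Measurable (lossSeq loss i n) := fun i n =>
    ((hs i).measurable_loss n).mono ((hs i).env_le 0) le_rfl
  have hint : ∀ i n (f : Ω → ℝ), Measurable f → (∀ ω, f ω ∈ Set.Icc (0 : ℝ) 1) →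
      Integrable (fun ω => f ω * lossSeq loss i n ω) P := fun i n f hf hu =>
    integrable_of_bounded (hf.mul (hx0 i n)) (C := 1)
      fun ω => abs_le_one_of_mem (mul_mem_unit (hu ω) ((hs i).loss_mem n ω))
  have iB := fun i n => hint i n _ ((hs i).measurable_draw n) ((hs i).draw_unit n)
  have iA := fun i n => hint i n _ ((hs i).measurable_event.mono ((hs i).env_le 0) le_rfl)
    (hs i).event_unit
  have ip := fun i n => hint i n _
    (((hs i).measurable_prob n).mono ((hs i).hist_le_ambient n) le_rfl) ((hs i).prob_mem n)
  have isub : ∀ i n, Integrable (fun ω => drawSeq act i n ω * lossSeq loss i n ω -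
      bestInd best i ω * lossSeq loss i n ω) P := fun i n => (iB i n).sub (iA i n)
  simp_rw [regret_eq hbandit.best_le]
  rw [integral_finsetSum _ fun i _ => integrable_finsetSum _ fun n _ => isub i n]
  refine Finset.sum_congr rfl fun i _ => ?_
  rw [integral_finsetSum _ fun n _ => isub i n]
  refine Finset.sum_congr rfl fun n hn => ?_
  rw [integral_sub (iB i n) (iA i n), (hs i).integral_draw n (Finset.mem_range.1 hn) _
    (((hs i).measurable_loss n).mono ((hs i).mono_env n.zero_le) le_rfl)
    ⟨1, fun ω => abs_le_one_of_mem ((hs i).loss_mem n ω)⟩, ← integral_sub (ip i n) (iA i n)]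
  simp only [sub_mul]

/-! ### Regret bounds over all arms -/

/-- The regret of Thompson Sampling in terms of a common bound `S` on the truncated posterior
losses of the arms. -/
theorem integral_regret_le (hbandit : IsBayesianBandit loss best)
    (hts : IsThompsonSampling P loss best act) {γ c S : ℝ} (hγ : 0 < γ) (hc : 0 < c)
    (hS : ∀ i, ∑ n ∈ Finset.range T,
      ∫ ω, min (posterior P loss best act i n ω) γ * lossSeq loss i n ω ∂P ≤ S) :
    ∫ ω, regret loss act ω ∂P ≤ d * S + priorEntropy P best / c + c * (d * S / γ) := by
  rw [integral_regret_eq hbandit hts]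
  calc _ ≤ ∑ i, (S + Real.negMulLog (P.real (best ⁻¹' {i})) / c + c * (S / γ)) :=
        Finset.sum_le_sum fun i _ => (isPosteriorSampling hbandit hts i).sum_integral_regret_le hγ hc
          (posterior_zero hbandit.measurable_best i) (hS i)
    _ = _ := by
        rw [Finset.sum_add_distrib, Finset.sum_add_distrib, ← Finset.sum_div, priorEntropy]
        simp only [Finset.sum_const, Finset.card_univ, Fintype.card_fin, nsmul_eq_mul]
        ring

lemma priorEntropy_nonneg : 0 ≤ priorEntropy P best :=
  Finset.sum_nonneg fun _ _ => Real.negMulLog_nonneg measureReal_nonneg measureReal_le_one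

/-- The regret bound for at least two rounds. -/
theorem integral_regret_le_of_two_le (hbandit : IsBayesianBandit loss best)
    (hts : IsThompsonSampling P loss best act) {L : ℝ} (hL : 0 < L)
    (hbest : ∀ᵐ ω ∂P, bestLoss loss ω ≤ L) (hd : 0 < d) (hT : 2 ≤ T) :
    ∫ ω, regret loss act ω ∂P ≤
      d * (6 * Real.log T) + 2 * √(priorEntropy P best * (d * (6 * L))) := by
  have hd' : (0 : ℝ) < d := by exact_mod_cast hd
  have hlog2 : Real.log 2 ≤ Real.log T := Real.log_le_log two_pos (by exact_mod_cast hT)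
  -- Absorbs the additive 2 in 3 log T + 2, whence S = 6 log T. With γ = log T / L the ratio S/γ is
  -- 6L, free of T.
  have hlog : 2 ≤ 3 * Real.log T := by linarith [Real.log_two_gt_d9]
  have hlog0 : 0 < Real.log T := by linarith
  refine le_two_sqrt_of_forall priorEntropy_nonneg (by positivity) fun c hc => ?_
  have hγ : 0 < Real.log T / L := div_pos hlog0 hL
  refine (integral_regret_le hbandit hts (S := 6 * Real.log T) hγ hc fun i => ?_).trans
    (le_of_eq ?_)
  · refine ((isPosteriorSampling hbandit hts i).sum_integral_min_le (L := L) (by omega) hγ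
      (div_mul_cancel₀ _ hL.ne') ?_).trans (by linarith)
    filter_upwards [hbest] with ω hω hi
    have hbi : best ω = i := by
      by_contra hne
      simp [bestInd, hne] at hi
    rwa [sum_lossSeq, ← hbi, ← bestLoss_eq (fun i ω => hbandit.best_le ω i)]
  · field_simp

/-- The regret bound for at most one round. -/
theorem integral_regret_le_of_le_one (hbandit : IsBayesianBandit loss best)
    (hts : IsThompsonSampling P loss best act) (hd : 0 < d) (hT : T ≤ 1) :
    ∫ ω, regret loss act ω ∂P ≤ 2 * √(priorEntropy P best * d) := by
  have hd' : (0 : ℝ) < d := by exact_mod_cast hd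
  rw [← zero_add (2 * √_)]
  refine le_two_sqrt_of_forall priorEntropy_nonneg hd' fun c hc => ?_
  refine le_of_forall_pos_le_add fun ε hε => ?_
  -- Here log T = 0 would give γ = 0. With at most one round S = γ works for every γ > 0, so dS = ε
  -- is arbitrarily small while dS/γ = d.
  have hγ : 0 < ε / d := div_pos hε hd'
  refine (integral_regret_le hbandit hts (S := ε / d) hγ hc fun i => ?_).trans (le_of_eq ?_)
  · have hs := isPosteriorSampling hbandit hts i
    calc _ ≤ ∑ n ∈ Finset.range T, ∫ _, ε / d ∂P := by
          refine Finset.sum_le_sum fun n _ => integral_mono_of_nonneg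
            (Filter.Eventually.of_forall fun ω =>
              mul_nonneg (le_min (hs.prob_mem n ω).1 hγ.le) (hs.loss_mem n ω).1)
            (integrable_const _) (Filter.Eventually.of_forall fun ω => ?_)
          calc _ ≤ ε / d * 1 := mul_le_mul (min_le_right _ _) (hs.loss_mem n ω).2
                (hs.loss_mem n ω).1 hγ.le
            _ = _ := mul_one _
      _ = T * (ε / d) := by simp
      _ ≤ 1 * (ε / d) := mul_le_mul_of_nonneg_right (by exact_mod_cast hT) hγ.le
      _ = _ := one_mul _
  · field_simp
    ring

lemma integral_regret_le_horizon (hbandit : IsBayesianBandit loss best) :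
    ∫ ω, regret loss act ω ∂P ≤ T := by
  have h : ∀ ω, regret loss act ω ≤ T := fun ω => by
    have h1 : ∑ t, loss t (act t ω) ω ≤ ∑ _t : Fin T, (1 : ℝ) :=
      Finset.sum_le_sum fun t _ => (hbandit.loss_mem t _ ω).2
    have h2 : 0 ≤ bestLoss loss ω := Real.iInf_nonneg fun i =>
      Finset.sum_nonneg fun t _ => (hbandit.loss_mem t i ω).1
    simp only [Finset.sum_const, Finset.card_univ, Fintype.card_fin, nsmul_eq_mul, mul_one] at h1
    rw [regret]
    linarith
  by_cases hi : Integrable (regret loss act) P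
  · refine (integral_mono hi (integrable_const (T : ℝ)) h).trans (by simp)
  -- A non-integrable regret has integral 0 by convention.
  · rw [integral_undef hi]
    positivity

end BayesBandit

/-! ### The main theorem -/

theorem mainTheorem6 :
    ∃ C : ℝ, 0 < C ∧
      ∀ (Ω : Type*) [MeasurableSpace Ω] (P : Measure Ω) [IsProbabilityMeasure P]
        (T d : ℕ) (loss : Fin T → Fin d → Ω → ℝ) (best : Ω → Fin d) (act : Fin T → Ω → Fin d)
        (Lbar : ℝ),
        BayesBandit.IsBayesianBandit loss best →
        BayesBandit.IsThompsonSampling P loss best act →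
        0 < Lbar →
        (∀ᵐ ω ∂P, BayesBandit.bestLoss loss ω ≤ Lbar) →
        ∫ ω, BayesBandit.regret loss act ω ∂P ≤
          C * (√(BayesBandit.priorEntropy P best * d * Lbar)
            + d * Real.log Lbar ^ 2 + d * Real.log T) := by
  -- For T ≥ 2 the logarithmic term has coefficient 6, and the root has 2√6 ≤ 6.
  refine ⟨6, by norm_num, ?_⟩
  intro Ω _ P _ T d loss best act Lbar hbandit hts hL hbest
  obtain ⟨ω₀⟩ : Nonempty Ω := nonempty_of_isProbabilityMeasure P
  have hd : 0 < d := (best ω₀).pos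
  have hd1 : (1 : ℝ) ≤ d := by exact_mod_cast hd
  have hlogT : 0 ≤ d * Real.log T := mul_nonneg (by positivity) (Real.log_natCast_nonneg T)
  have hlogL : 0 ≤ d * Real.log Lbar ^ 2 := by positivity
  set H := BayesBandit.priorEntropy P best
  have hsqrt := Real.sqrt_nonneg (H * d * Lbar)
  rcases le_or_gt 2 T with hT | hT
  · have h := BayesBandit.integral_regret_le_of_two_le hbandit hts hL hbest hd hT
    have h2 : √(H * (d * (6 * Lbar))) ≤ 3 * √(H * d * Lbar) := by
      rw [show H * (d * (6 * Lbar)) = 6 * (H * d * Lbar) by ring, Real.sqrt_mul (by norm_num)]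
      exact mul_le_mul_of_nonneg_right (Real.sqrt_le_iff.2 (by norm_num)) hsqrt
    linarith
  · rcases le_or_gt (1 / 2) Lbar with hL2 | hL2
    · have h := BayesBandit.integral_regret_le_of_le_one hbandit hts hd (by omega)
      have hH : 0 ≤ H := BayesBandit.priorEntropy_nonneg
      have h2 : √(H * d) ≤ 2 * √(H * d * Lbar) := by
        rw [Real.sqrt_le_iff]
        refine ⟨by positivity, ?_⟩
        rw [mul_pow, Real.sq_sqrt (by positivity)]
        nlinarith [mul_nonneg hH (Nat.cast_nonneg (α := ℝ) d)]
      linarith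
    -- The only case that needs the (log Lbar)² term: log T vanishes and the root may be tiny, but
    -- the regret is at most 1 and log² Lbar ≥ 1/4.
    · have h := BayesBandit.integral_regret_le_horizon (P := P) (act := act) hbandit
      have hT1 : (T : ℝ) ≤ 1 := by exact_mod_cast (by omega : T ≤ 1)
      have h1 : Real.log Lbar ≤ -Real.log 2 := by
        rw [← Real.log_inv]
        exact Real.log_le_log hL (by linarith)
      have h2 : 1 / 4 ≤ Real.log Lbar ^ 2 := by nlinarith [Real.log_two_gt_d9]
      have h3 : 1 / 4 ≤ d * Real.log Lbar ^ 2 := by nlinarith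
      linarith
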